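/- Let $T\ge 1$ and let $A\in\mathbb R^{n\times n}$, $B\in\mathbb R^{n\times m}$, $C\in\mathbb R^{p\times n}$, $D\in\mathbb R^{p\times m}$ with spectral radius $\rho(A)<1$. Consider the system $$h_{t+1}=Ah_t+Bu_t,\qquad y_t=Ch_t+Du_t+\zeta_t\qquad(t=0,1,2,\dots)$$ with an arbitrary (deterministic or random) initial state $h_0$. The inputs $u_0,u_1,\dots$ are independent, each with law $\mathcal N(0,\Sigma)$, where $\Sigma$ is positive definite. Each measurement noise vector $\zeta_t$ has law $\mathcal N(0,\Sigma_\zeta)$, where $\Sigma_\zeta$ is positive semidefinite (possibly zero). The process $(\zeta_t)_t$ is independent of the process $(u_t)_t$. For $t\ge 1$ let $x_t\in\mathbb R^{mT}$ be the vector of the last $T$ inputs, $x_t=[u_t'\ u_{t-1}'\ \cdots\ u_{t-T+1}']'$, where $u_s$ is replaced by $0$ for $s\le 0$. Let $$\Theta_T=[D\ \ CB\ \ CAB\ \ \cdots\ \ CA^{T-2}B]\in\mathbb R^{p\times mT},$$ so that $y_t=\Theta_Tx_t+CA^{T-1}h_{t-T+1}+\zeta_t$ for $t\ge T$. Consider the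 infinite-horizon regression $$\min_{M\in\mathbb R^{p\times mT}}J(M),\qquad J(M)=\lim_{N\to\infty}\frac1{2N}\sum_{t=1}^N\|y_t-Mx_t\|_2^2,$$ in which the noise $\zeta_t$ is present in $y_t$ and the hidden-state term $CA^{T-1}h_{t-T+1}$ is not modelled. 1. Almost surely, if the limit $J(M)$ exists as a real number for every $M$, then $\Theta_T$ is the unique global minimizer of $J$. 2. If moreover the noise vectors $\zeta_0,\zeta_1,\dots$ are independent of each other, then almost surely $J(M)$ does exist for every $M$. Hence, almost surely, the infinite-horizon regression has exactly one solution, and this solution is $\Theta_T$. -/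

import Mathlib

open MeasureTheory ProbabilityTheory Filter Topology

noncomputable section

/-- The hidden state of the system with input `u` and initial state `h₀`:
`h_0 = h₀` and `h_{t+1} = A h_t + B u_t`. -/
def hiddenState {n m : ℕ} (A : Matrix (Fin n) (Fin n) ℝ) (B : Matrix (Fin n) (Fin m) ℝ)
    (h₀ : EuclideanSpace ℝ (Fin n)) (u : ℕ → EuclideanSpace ℝ (Fin m)) :
    ℕ → EuclideanSpace ℝ (Fin n)
  | 0 => h₀
  | t + 1 => Matrix.toEuclideanLin A (hiddenState A B h₀ u t) + Matrix.toEuclideanLin B (u t)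

/-- The measured output `y_t = C h_t + D u_t + ζ_t`. -/
def systemOutput {n m p : ℕ} (A : Matrix (Fin n) (Fin n) ℝ) (B : Matrix (Fin n) (Fin m) ℝ)
    (C : Matrix (Fin p) (Fin n) ℝ) (D : Matrix (Fin p) (Fin m) ℝ)
    (h₀ : EuclideanSpace ℝ (Fin n)) (u : ℕ → EuclideanSpace ℝ (Fin m))
    (ζ : ℕ → EuclideanSpace ℝ (Fin p)) (t : ℕ) : EuclideanSpace ℝ (Fin p) :=
  Matrix.toEuclideanLin C (hiddenState A B h₀ u t) + Matrix.toEuclideanLin D (u t) + ζ t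

/-- The regressor `x_t`, made of `T` blocks of length `m`: block `j` (for `0 ≤ j < T`) is `u_{t-j}`
if `t - j ≥ 1`, and is zero otherwise. The entry `(j, k)` is coordinate `k` of block `j`. -/
def regressor {m : ℕ} (T : ℕ) (u : ℕ → EuclideanSpace ℝ (Fin m)) (t : ℕ) :
    EuclideanSpace ℝ (Fin T × Fin m) :=
  WithLp.toLp 2 fun jk => if (jk.1 : ℕ) < t then u (t - jk.1) jk.2 else 0

/-- The `i`-th Markov parameter: `D` for `i = 0` and `C A^{i-1} B` for `i ≥ 1`. -/
def markovParameter {n m p : ℕ} (A : Matrix (Fin n) (Fin n) ℝ) (B : Matrix (Fin n) (Fin m) ℝ)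
    (C : Matrix (Fin p) (Fin n) ℝ) (D : Matrix (Fin p) (Fin m) ℝ) :
    ℕ → Matrix (Fin p) (Fin m) ℝ
  | 0 => D
  | i + 1 => C * A ^ i * B

/-- The block row `Θ_T = [D  CB  CAB  ⋯  C A^{T-2} B]` of the first `T` Markov parameters. -/
def truncatedMarkov {n m p : ℕ} (A : Matrix (Fin n) (Fin n) ℝ) (B : Matrix (Fin n) (Fin m) ℝ)
    (C : Matrix (Fin p) (Fin n) ℝ) (D : Matrix (Fin p) (Fin m) ℝ) (T : ℕ) :
    Matrix (Fin p) (Fin T × Fin m) ℝ :=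
  Matrix.of fun i jk => markovParameter A B C D jk.1 i jk.2

/-- The finite-horizon cost `(1 / 2N) ∑_{t=1}^N ‖y_t - M x_t‖₂²`. -/
def regressionCost {p : ℕ} {ι : Type*} [Fintype ι] [DecidableEq ι]
    (y : ℕ → EuclideanSpace ℝ (Fin p)) (x : ℕ → EuclideanSpace ℝ ι)
    (M : Matrix (Fin p) ι ℝ) (N : ℕ) : ℝ :=
  1 / (2 * (N : ℝ)) * ∑ t ∈ Finset.Icc 1 N, ‖y t - Matrix.toEuclideanLin M (x t)‖ ^ 2

/-- `J` is the infinite-horizon cost: for every `M`, the finite-horizon costs of `M` converge to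
the real number `J M` as the horizon tends to infinity. -/
def IsLimitCost {p : ℕ} {ι : Type*} [Fintype ι] [DecidableEq ι]
    (y : ℕ → EuclideanSpace ℝ (Fin p)) (x : ℕ → EuclideanSpace ℝ ι)
    (J : Matrix (Fin p) ι ℝ → ℝ) : Prop :=
  ∀ M, Tendsto (regressionCost y x M) atTop (𝓝 (J M))

/-- `M` solves the infinite-horizon regression: the infinite-horizon cost exists and `M` is one of
its global minimizers. -/
def IsRegressionSolution {p : ℕ} {ι : Type*} [Fintype ι] [DecidableEq ι]
    (y : ℕ → EuclideanSpace ℝ (Fin p)) (x : ℕ → EuclideanSpace ℝ ι)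
    (M : Matrix (Fin p) ι ℝ) : Prop :=
  ∃ J : Matrix (Fin p) ι ℝ → ℝ, IsLimitCost y x J ∧ IsMinOn J Set.univ M

end

/-! The argument is pathwise. For `t ≥ T` the residual of `M` is `(Θ_T - M) x_t + e_t` with `e_t = C
A^{T-1} h_{t-T+1} + ζ_t`. The state in `e_t` contains only inputs older than the window `x_t`, so
`e_t` is asymptotically uncorrelated with `x_t`, while the averages of `x_t x_t'` tend to the
positive definite matrix `1 ⊗ Σ`. Hence the excess cost of `M` over `Θ_T` always converges, to a
quadratic form that is positive for `M ≠ Θ_T`, even if the costs themselves diverge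
(`IsEmpiricallyWhite.excess`, `isRegressionSolution_iff_of_excess`). Existence of `J` thus reduces
to existence of `J(Θ_T)`, which follows once the noise obeys a law of large numbers.

Probability enters only through countably many Cesàro limits of products of inputs and noise.
Squares come from the i.i.d. strong law, mixed products from `ae_hasCesaroMean_zero_of_orthogonal`,
which tolerates noise that is dependent in time. These limits pass to the state by unrolling the
recursion `k` steps: finitely many inputs remain, plus a term `A^k h` whose average energy decays
geometrically in `k` (`hasCesaroMean_mul_state`, `exists_hasCesaroMean_sq_state`). No stationarity
is needed, and `h₀` is arbitrary. -/

/-! ### Cesàro means and their stability under approximation -/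

/-- The sequence of averages `(a 0 + ⋯ + a (N - 1)) / N` converges to `l`. -/
def HasCesaroMean (a : ℕ → ℝ) (l : ℝ) : Prop :=
  Tendsto (fun N : ℕ => (∑ t ∈ Finset.range N, a t) / N) atTop (𝓝 l)

namespace HasCesaroMean

variable {a b : ℕ → ℝ} {l l' : ℝ}

lemma unique (h : HasCesaroMean a l) (h' : HasCesaroMean a l') : l = l' :=
  tendsto_nhds_unique h h'

lemma add (h : HasCesaroMean a l) (h' : HasCesaroMean b l') :
    HasCesaroMean (fun t => a t + b t) (l + l') :=
  (Tendsto.add h h').congr fun N => by rw [Finset.sum_add_distrib, add_div]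

lemma const_mul (h : HasCesaroMean a l) (c : ℝ) : HasCesaroMean (fun t => c * a t) (c * l) :=
  (Tendsto.const_mul c h).congr fun N => by rw [← Finset.mul_sum, mul_div_assoc]

lemma zero : HasCesaroMean (fun _ => 0) 0 := by
  simp [HasCesaroMean]

lemma sum {ι : Type*} (s : Finset ι) {a : ι → ℕ → ℝ} {l : ι → ℝ}
    (h : ∀ i ∈ s, HasCesaroMean (a i) (l i)) :
    HasCesaroMean (fun t => ∑ i ∈ s, a i t) (∑ i ∈ s, l i) :=
  (tendsto_finsetSum s h).congr fun N => by
    rw [Finset.sum_comm, Finset.sum_div]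

lemma shift_one_iff (a : ℕ → ℝ) (l : ℝ) :
    HasCesaroMean (fun t => a (t + 1)) l ↔ HasCesaroMean a l := by
  have key : ∀ N : ℕ, (∑ t ∈ Finset.range N, a (t + 1))
      = ∑ t ∈ Finset.range (N + 1), a t - a 0 := fun N => by
    rw [Finset.sum_range_succ']; ring
  have h1 : Tendsto (fun N : ℕ => ((N + 1 : ℕ) : ℝ) / N) atTop (𝓝 1) := by
    have := (tendsto_const_nhds (x := (1 : ℝ))).add (tendsto_const_div_atTop_nhds_zero_nat (1 : ℝ))
    rw [add_zero] at this
    refine this.congr' ?_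
    filter_upwards [eventually_ne_atTop 0] with N hN
    have : (N : ℝ) ≠ 0 := by exact_mod_cast hN
    push_cast
    field_simp
  have h0 : Tendsto (fun N : ℕ => a 0 / (N : ℝ)) atTop (𝓝 0) :=
    tendsto_const_div_atTop_nhds_zero_nat _
  unfold HasCesaroMean
  rw [← tendsto_add_atTop_iff_nat (f := fun N : ℕ => (∑ t ∈ Finset.range N, a t) / N) 1]
  constructor
  · intro h
    have := (h.add h0).div h1 one_ne_zero
    rw [add_zero, div_one] at this
    refine this.congr' ?_
    filter_upwards [eventually_ne_atTop 0] with N hN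
    have : (N : ℝ) ≠ 0 := by exact_mod_cast hN
    have : ((N + 1 : ℕ) : ℝ) ≠ 0 := by positivity
    simp only [Pi.div_apply, key]
    field_simp
    ring
  · intro h
    have := (h.mul h1).sub h0
    rw [sub_zero, mul_one] at this
    refine this.congr' ?_
    filter_upwards [eventually_ne_atTop 0] with N hN
    have : (N : ℝ) ≠ 0 := by exact_mod_cast hN
    have : ((N + 1 : ℕ) : ℝ) ≠ 0 := by positivity
    simp only [key]
    field_simp

lemma shift_iff (a : ℕ → ℝ) (l : ℝ) (k : ℕ) :
    HasCesaroMean (fun t => a (t + k)) l ↔ HasCesaroMean a l := by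
  induction k generalizing a with
  | zero => rfl
  | succ k ih =>
    rw [← shift_one_iff a, ← ih (fun t => a (t + 1))]
    rfl

lemma eventually_le (h : HasCesaroMean a l) {c : ℝ} (hc : l < c) :
    ∀ᶠ N : ℕ in atTop, (∑ t ∈ Finset.range N, a t) / N ≤ c :=
  (h.eventually_lt_const hc).mono fun _ hN => hN.le

/-- If the shift `a (t + k)` differs from a sequence with Cesàro mean `l` by an error of average size
at most `ε`, then the averages of `a` are eventually within `3 ε` of `l`. -/
lemma eventually_abs_sub_le {k : ℕ} {ε : ℝ} (hε : 0 < ε) (hb : HasCesaroMean b l)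
    (hr : ∀ᶠ N : ℕ in atTop, |(∑ t ∈ Finset.range N, (a (t + k) - b t)) / N| ≤ ε) :
    ∀ᶠ N : ℕ in atTop, |(∑ t ∈ Finset.range N, a t) / N - l| ≤ 3 * ε := by
  -- Truncated subtraction repeats `b 0` for `t < k`, which affects only finitely many terms. The
  -- three `ε` pay for the average error, for the initial terms `c`, and for the convergence of
  -- `b'`.
  set b' : ℕ → ℝ := fun t => b (t - k) with hb'
  have hb'l : HasCesaroMean b' l := by
    rw [← shift_iff b' l k]
    simpa [hb'] using hb
  set c := ∑ t ∈ Finset.range k, (a t - b' t) with hc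
  have hsum : ∀ N, ∑ t ∈ Finset.range (N + k), (a t - b' t)
      = c + ∑ t ∈ Finset.range N, (a (t + k) - b t) := fun N => by
    rw [add_comm N k, Finset.sum_range_add]
    simp [hb', hc, add_comm]
  have hc0 : Tendsto (fun N : ℕ => |c| / (N : ℝ)) atTop (𝓝 0) :=
    tendsto_const_div_atTop_nhds_zero_nat _
  have h1 : ∀ᶠ N : ℕ in atTop, |(∑ t ∈ Finset.range N, (a t - b' t)) / N| ≤ 2 * ε := by
    have : ∀ᶠ N : ℕ in atTop,
        |(∑ t ∈ Finset.range (N + k), (a t - b' t)) / (N + k : ℕ)| ≤ 2 * ε := by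
      filter_upwards [hr, hc0.eventually_lt_const hε, eventually_gt_atTop 0] with N h1 h2 h3
      have hN : (0 : ℝ) < N := by exact_mod_cast h3
      have hNk : (N : ℝ) ≤ (N + k : ℕ) := by push_cast; linarith [k.cast_nonneg (α := ℝ)]
      rw [hsum, abs_div, abs_of_nonneg (Nat.cast_nonneg (α := ℝ) (N + k)),
        div_le_iff₀ (hN.trans_le hNk)]
      rw [abs_div, abs_of_pos hN, div_le_iff₀ hN] at h1
      rw [div_lt_iff₀ hN] at h2
      refine (abs_add_le _ _).trans ?_
      nlinarith
    obtain ⟨N₀, hN₀⟩ := eventually_atTop.1 this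
    refine eventually_atTop.2 ⟨N₀ + k, fun N hN => ?_⟩
    have := hN₀ (N - k) (by omega)
    rwa [Nat.sub_add_cancel (by omega)] at this
  filter_upwards [h1, (Metric.tendsto_nhds.1 hb'l) ε hε] with N h1 h2
  rw [Real.dist_eq] at h2
  rw [Finset.sum_sub_distrib, sub_div] at h1
  rw [abs_le] at *
  rw [abs_lt] at h2
  constructor <;> linarith

/-- A sequence which, after a shift and up to an error of arbitrarily small average size, has a
Cesàro mean, has a Cesàro mean itself. -/
lemma exists_of_approx
    (h : ∀ ε > 0, ∃ (k : ℕ) (b : ℕ → ℝ) (l : ℝ), HasCesaroMean b l ∧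
      ∀ᶠ N : ℕ in atTop, |(∑ t ∈ Finset.range N, (a (t + k) - b t)) / N| ≤ ε) :
    ∃ l, HasCesaroMean a l := by
  refine cauchySeq_tendsto_of_complete (Metric.cauchySeq_iff'.2 fun ε hε => ?_)
  -- Two averages, each within `3ε/7` of `l`, differ by less than `ε`. The limit `l` may vary with
  -- `ε`, hence the Cauchy criterion.
  obtain ⟨k, b, l, hb, hr⟩ := h (ε / 7) (by positivity)
  obtain ⟨N₀, hN₀⟩ := eventually_atTop.1 (eventually_abs_sub_le (by positivity) hb hr)
  refine ⟨N₀, fun N hN => ?_⟩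
  have h1 := abs_le.1 (hN₀ N hN)
  have h2 := abs_le.1 (hN₀ N₀ le_rfl)
  rw [Real.dist_eq, abs_lt]
  constructor <;> linarith

/-- A sequence which, after a shift and up to an error of arbitrarily small average size, has
Cesàro mean `l`, has Cesàro mean `l` itself. -/
lemma of_approx
    (h : ∀ ε > 0, ∃ (k : ℕ) (b : ℕ → ℝ), HasCesaroMean b l ∧
      ∀ᶠ N : ℕ in atTop, |(∑ t ∈ Finset.range N, (a (t + k) - b t)) / N| ≤ ε) :
    HasCesaroMean a l := by
  refine Metric.tendsto_nhds.2 fun ε hε => ?_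
  obtain ⟨k, b, hb, hr⟩ := h (ε / 4) (by positivity)
  filter_upwards [eventually_abs_sub_le (by positivity) hb hr] with N hN
  rw [Real.dist_eq]
  linarith

end HasCesaroMean

/-! ### Stable linear recursions -/

/-- The majorant of a hidden state which decays at rate `r` and is driven by `x`. -/
noncomputable def decayingSum (r g₀ : ℝ) (x : ℕ → ℝ) : ℕ → ℝ
  | 0 => g₀
  | t + 1 => r * decayingSum r g₀ x t + x t

lemma decayingSum_nonneg {r g₀ : ℝ} {x : ℕ → ℝ} (hr : 0 ≤ r) (hg : 0 ≤ g₀) (hx : ∀ t, 0 ≤ x t)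
    (t : ℕ) : 0 ≤ decayingSum r g₀ x t := by
  induction t with
  | zero => exact hg
  | succ t ih => exact add_nonneg (mul_nonneg hr ih) (hx t)

/-- Convexity of the square with weights `r` and `1 - r` gives `(r g + x)² ≤ r g² + x² / (1 - r)`.
Summing over time, the shifted sum of `g²` is absorbed on the left. -/
lemma sum_sq_decayingSum_le {r g₀ : ℝ} {x : ℕ → ℝ} (hr : 0 ≤ r) (hr1 : r < 1) (N : ℕ) :
    (1 - r) * ∑ t ∈ Finset.range N, decayingSum r g₀ x t ^ 2
      ≤ g₀ ^ 2 + (∑ t ∈ Finset.range N, x t ^ 2) / (1 - r) := by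
  have h1 : (0 : ℝ) < 1 - r := by linarith
  have step : ∀ t, decayingSum r g₀ x (t + 1) ^ 2
      ≤ r * decayingSum r g₀ x t ^ 2 + x t ^ 2 / (1 - r) := fun t => by
    have : r * decayingSum r g₀ x t ^ 2 + x t ^ 2 / (1 - r) - decayingSum r g₀ x (t + 1) ^ 2
        = r * ((1 - r) * decayingSum r g₀ x t - x t) ^ 2 / (1 - r) := by
      rw [decayingSum]
      field_simp
      ring
    have : 0 ≤ r * ((1 - r) * decayingSum r g₀ x t - x t) ^ 2 / (1 - r) := by positivity
    linarith
  have h2 : ∀ N, ∑ t ∈ Finset.range N, decayingSum r g₀ x (t + 1) ^ 2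
      ≤ r * ∑ t ∈ Finset.range N, decayingSum r g₀ x t ^ 2
        + (∑ t ∈ Finset.range N, x t ^ 2) / (1 - r) := fun N => by
    rw [Finset.mul_sum, Finset.sum_div, ← Finset.sum_add_distrib]
    exact Finset.sum_le_sum fun t _ => step t
  have h3 : ∑ t ∈ Finset.range N, decayingSum r g₀ x t ^ 2 + decayingSum r g₀ x N ^ 2
      = ∑ t ∈ Finset.range N, decayingSum r g₀ x (t + 1) ^ 2 + g₀ ^ 2 := by
    rw [← Finset.sum_range_succ, Finset.sum_range_succ', decayingSum]
  nlinarith [h2 N, sq_nonneg (decayingSum r g₀ x N)]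

section StableRecursion

variable {E U : Type*} [NormedAddCommGroup E] [NormedSpace ℝ E]
  [NormedAddCommGroup U] [NormedSpace ℝ U]

/-- The iterates of `A` decay geometrically. -/
def IsGeometricallyStable (A : E →L[ℝ] E) : Prop :=
  ∃ c r : ℝ, 0 ≤ c ∧ 0 ≤ r ∧ r < 1 ∧ ∀ k v, ‖(A ^ k) v‖ ≤ c * r ^ k * ‖v‖

open HasCesaroMean

variable {A : E →L[ℝ] E} {B : U →L[ℝ] E} {h : ℕ → E} {u : ℕ → U}

lemma norm_pow_apply_le_decayingSum {c r : ℝ} (hc : 0 ≤ c) (hr : 0 ≤ r)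
    (hA : ∀ k v, ‖(A ^ k) v‖ ≤ c * r ^ k * ‖v‖) (hh : ∀ t, h (t + 1) = A (h t) + B (u t))
    (k t : ℕ) :
    ‖(A ^ k) (h t)‖ ≤ r ^ k * decayingSum r (c * ‖h 0‖) (fun t => c * ‖B‖ * ‖u t‖) t := by
  -- All `k` are treated at once: the bound at time `t + 1` for `A ^ k` uses the one at time `t` for
  -- `A ^ (k + 1)`. The constant `c` is then paid once per input and does not compound.
  induction t generalizing k with
  | zero => exact (hA k _).trans (le_of_eq (by rw [decayingSum]; ring))
  | succ t ih =>
    have h1 : (A ^ k) (A (h t)) = (A ^ (k + 1)) (h t) := by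
      rw [pow_succ]; rfl
    rw [hh, map_add, h1, decayingSum]
    calc ‖(A ^ (k + 1)) (h t) + (A ^ k) (B (u t))‖
        ≤ ‖(A ^ (k + 1)) (h t)‖ + ‖(A ^ k) (B (u t))‖ := norm_add_le _ _
      _ ≤ r ^ (k + 1) * decayingSum r (c * ‖h 0‖) (fun t => c * ‖B‖ * ‖u t‖) t
          + c * r ^ k * (‖B‖ * ‖u t‖) := by
        gcongr
        · exact ih _
        · exact (hA k _).trans (by gcongr; exact B.le_opNorm _)
      _ = _ := by ring

/-- A stable recursion whose input has bounded average energy: the energy that `h` retains after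
`k` more steps is bounded on average, with geometric decay in `k`. -/
lemma exists_majorant_of_stable (hA : IsGeometricallyStable A)
    (hh : ∀ t, h (t + 1) = A (h t) + B (u t)) {q : ℝ}
    (hu : HasCesaroMean (fun t => ‖u t‖ ^ 2) q) :
    ∃ (r G : ℝ) (g : ℕ → ℝ), 0 ≤ r ∧ r < 1 ∧ 0 ≤ G ∧ (∀ t, 0 ≤ g t) ∧
      (∀ k t, ‖(A ^ k) (h t)‖ ≤ r ^ k * g t) ∧
      ∀ᶠ N : ℕ in atTop, (∑ t ∈ Finset.range N, g (t + 1) ^ 2) / N ≤ G := by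
  obtain ⟨c, r, hc, hr, hr1, hA⟩ := hA
  have h1 : (0 : ℝ) < 1 - r := by linarith
  -- The factor `2 (|q| + 1)` bounds the input energy up to time `N + 1` divided by `N`, for large
  -- `N`.
  refine ⟨r, ((c * ‖h 0‖) ^ 2 + (c * ‖B‖) ^ 2 * (2 * (|q| + 1)) / (1 - r)) / (1 - r),
    decayingSum r (c * ‖h 0‖) (fun t => c * ‖B‖ * ‖u t‖), hr, hr1, by positivity,
    decayingSum_nonneg hr (by positivity) fun t => by positivity,
    norm_pow_apply_le_decayingSum hc hr hA hh, ?_⟩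
  have h2 := (tendsto_add_atTop_iff_nat 1).2 (show Tendsto _ _ _ from hu)
  filter_upwards [h2.eventually_lt_const (show q < |q| + 1 by linarith [le_abs_self q]),
    eventually_ge_atTop 1] with N hN hN1
  have hN1' : (1 : ℝ) ≤ N := by exact_mod_cast hN1
  rw [div_lt_iff₀ (by positivity)] at hN
  push_cast at hN
  set g := decayingSum r (c * ‖h 0‖) (fun t => c * ‖B‖ * ‖u t‖) with hg
  have h3 := sum_sq_decayingSum_le (g₀ := c * ‖h 0‖) (x := fun t => c * ‖B‖ * ‖u t‖) hr hr1 (N + 1)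
  rw [← hg] at h3
  have h4 : ∑ t ∈ Finset.range N, g (t + 1) ^ 2 ≤ ∑ t ∈ Finset.range (N + 1), g t ^ 2 := by
    rw [Finset.sum_range_succ' _ N]
    linarith [sq_nonneg (g 0)]
  simp only [mul_pow _ ‖u _‖, ← Finset.mul_sum] at h3
  have h5 : ∑ t ∈ Finset.range (N + 1), ‖u t‖ ^ 2 ≤ 2 * (|q| + 1) * N := by
    nlinarith [abs_nonneg q]
  rw [div_le_iff₀ (by positivity), div_mul_eq_mul_div, le_div_iff₀ h1]
  calc (∑ t ∈ Finset.range N, g (t + 1) ^ 2) * (1 - r)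
      ≤ (1 - r) * ∑ t ∈ Finset.range (N + 1), g t ^ 2 := by
        rw [mul_comm]; gcongr
    _ ≤ (c * ‖h 0‖) ^ 2 + (c * ‖B‖) ^ 2 * (∑ t ∈ Finset.range (N + 1), ‖u t‖ ^ 2) / (1 - r) := h3
    _ ≤ (c * ‖h 0‖) ^ 2 * N + (c * ‖B‖) ^ 2 * (2 * (|q| + 1) * N) / (1 - r) := by
        gcongr
        exact le_mul_of_one_le_right (by positivity) hN1'
    _ = _ := by ring

/-- If a scalar sequence is asymptotically uncorrelated with the inputs at all lags `≥ s₀`, then it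
is asymptotically uncorrelated with the states of a stable recursion at the same lags. -/
lemma hasCesaroMean_mul_state (hA : IsGeometricallyStable A)
    (hh : ∀ t, h (t + 1) = A (h t) + B (u t)) {q q' : ℝ}
    (hu : HasCesaroMean (fun t => ‖u t‖ ^ 2) q) {z : ℕ → ℝ}
    (hz : HasCesaroMean (fun t => z t ^ 2) q') {s₀ : ℕ}
    (hzu : ∀ s ≥ s₀, ∀ ψ : U →L[ℝ] ℝ, HasCesaroMean (fun t => z (t + s) * ψ (u t)) 0)
    (φ : E →L[ℝ] ℝ) : HasCesaroMean (fun t => z (t + s₀) * φ (h (t + 1))) 0 := by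
  -- Here `b` collects the inputs of the last `k` steps, seen at the lags `s, …, s + k - 1`, all at
  -- least `s₀`.
  have key : ∀ k s, s₀ ≤ s → ∃ b, HasCesaroMean b 0 ∧ ∀ t,
      z (t + k + s) * φ (h (t + k + 1)) = b t + z (t + k + s) * φ ((A ^ k) (h (t + 1))) := by
    intro k
    induction k with
    | zero => exact fun s _ => ⟨_, zero, fun t => by simp⟩
    | succ k ih =>
      intro s hs
      obtain ⟨b, hb, hbt⟩ := ih s hs
      refine ⟨fun t => b (t + 1) + z (t + 1 + (k + s)) * φ ((A ^ k) (B (u (t + 1)))), ?_,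
        fun t => ?_⟩
      · have h1 := (shift_iff _ _ 1).2 hb
        have h2 := (shift_iff _ _ 1).2 (hzu (k + s) (by omega) (φ ∘L (A ^ k) ∘L B))
        simpa using h1.add h2
      · have h1 := hbt (t + 1)
        rw [hh (t + 1), map_add, map_add, ← ContinuousLinearMap.comp_apply (A ^ k) A,
          ← ContinuousLinearMap.mul_def, ← pow_succ] at h1
        rw [show t + (k + 1) + s = t + 1 + k + s by ring,
          show t + (k + 1) + 1 = t + 1 + k + 1 by ring, h1]
        simp only [← add_assoc (t + 1) k s]
        ring
  obtain ⟨r, G, g, hr, hr1, hG, hg, hAg, hgG⟩ := exists_majorant_of_stable hA hh hu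
  refine of_approx fun ε hε => ?_
  -- The average of `z² + g²` is eventually below a bound independent of `k`, so the factor `r ^ k`
  -- alone makes the remainder small.
  have hlim : Tendsto (fun k : ℕ => ‖φ‖ * r ^ k * (|q'| + 1 + G)) atTop (𝓝 0) := by
    simpa using ((tendsto_pow_atTop_nhds_zero_of_lt_one hr hr1).const_mul ‖φ‖).mul_const
      (|q'| + 1 + G)
  obtain ⟨k, hk⟩ := (hlim.eventually_lt_const hε).exists
  obtain ⟨b, hb, hbt⟩ := key k s₀ le_rfl
  refine ⟨k, b, hb, ?_⟩
  have hz' := (shift_iff _ _ (k + s₀)).2 hz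
  filter_upwards [hz'.eventually_le (show q' < |q'| + 1 by linarith [le_abs_self q']), hgG]
    with N h1 h2
  have h3 : ∀ t, |z (t + k + s₀) * φ (h (t + k + 1)) - b t|
      ≤ ‖φ‖ * r ^ k * (z (t + (k + s₀)) ^ 2 + g (t + 1) ^ 2) := fun t => by
    rw [hbt, add_sub_cancel_left, abs_mul, add_assoc t k s₀]
    have h4 : |φ ((A ^ k) (h (t + 1)))| ≤ ‖φ‖ * (r ^ k * g (t + 1)) :=
      (φ.le_opNorm _).trans (by gcongr; exact hAg _ _)
    have h5 : |z (t + (k + s₀))| * g (t + 1) ≤ z (t + (k + s₀)) ^ 2 + g (t + 1) ^ 2 := by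
      rw [← sq_abs (z _)]
      nlinarith [sq_nonneg (|z (t + (k + s₀))| - g (t + 1)), sq_nonneg (z (t + (k + s₀))),
        sq_nonneg (|z (t + (k + s₀))|), sq_nonneg (g (t + 1))]
    calc |z (t + (k + s₀))| * |φ ((A ^ k) (h (t + 1)))|
        ≤ |z (t + (k + s₀))| * (‖φ‖ * (r ^ k * g (t + 1))) := by gcongr
      _ = ‖φ‖ * r ^ k * (|z (t + (k + s₀))| * g (t + 1)) := by ring
      _ ≤ _ := by gcongr
  rw [abs_div, Nat.abs_cast]
  calc |∑ t ∈ Finset.range N, (z (t + k + s₀) * φ (h (t + k + 1)) - b t)| / N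
      ≤ (∑ t ∈ Finset.range N, ‖φ‖ * r ^ k * (z (t + (k + s₀)) ^ 2 + g (t + 1) ^ 2)) / N := by
        gcongr
        exact (Finset.abs_sum_le_sum_abs _ _).trans (Finset.sum_le_sum fun t _ => h3 t)
    _ = ‖φ‖ * r ^ k * ((∑ t ∈ Finset.range N, z (t + (k + s₀)) ^ 2) / N
          + (∑ t ∈ Finset.range N, g (t + 1) ^ 2) / N) := by
        rw [← Finset.mul_sum, Finset.sum_add_distrib]; ring
    _ ≤ ‖φ‖ * r ^ k * (|q'| + 1 + G) := by gcongr
    _ ≤ ε := hk.le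

/-- If the inputs of a stable recursion have a limiting second moment and are asymptotically
uncorrelated with the preceding states, then the states have a limiting second moment. -/
lemma exists_hasCesaroMean_sq_state (hA : IsGeometricallyStable A)
    (hh : ∀ t, h (t + 1) = A (h t) + B (u t)) {q : ℝ}
    (hu : HasCesaroMean (fun t => ‖u t‖ ^ 2) q)
    (hu2 : ∀ ψ : U →L[ℝ] ℝ, ∃ l, HasCesaroMean (fun t => ψ (u t) ^ 2) l)
    (hhu : ∀ (φ : E →L[ℝ] ℝ) (ψ : U →L[ℝ] ℝ),
      HasCesaroMean (fun t => φ (h (t + 1)) * ψ (u (t + 1))) 0)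
    (φ : E →L[ℝ] ℝ) : ∃ l, HasCesaroMean (fun t => φ (h (t + 1)) ^ 2) l := by
  -- Expanding the square, the cross terms between a state and the next input average to zero by
  -- `hhu`; the squares of the inputs have limits by `hu2`.
  have key : ∀ k, ∃ b l, HasCesaroMean b l ∧ ∀ t,
      φ (h (t + k + 1)) ^ 2 = b t + φ ((A ^ k) (h (t + 1))) ^ 2 := by
    intro k
    induction k with
    | zero => exact ⟨_, 0, zero, fun t => by simp⟩
    | succ k ih =>
      obtain ⟨b, l, hb, hbt⟩ := ih
      obtain ⟨l', hl'⟩ := hu2 (φ ∘L (A ^ k) ∘L B)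
      have h1 := (shift_iff _ _ 1).2 hb
      have h2 := (hhu (φ ∘L A ^ (k + 1)) (φ ∘L (A ^ k) ∘L B)).const_mul 2
      have h3 := (shift_iff _ _ 1).2 hl'
      refine ⟨_, _, (h1.add h2).add h3, fun t => ?_⟩
      have h4 := hbt (t + 1)
      rw [hh (t + 1), map_add, map_add, ← ContinuousLinearMap.comp_apply (A ^ k) A,
        ← ContinuousLinearMap.mul_def, ← pow_succ] at h4
      rw [show t + (k + 1) + 1 = t + 1 + k + 1 by ring, h4]
      simp only [ContinuousLinearMap.comp_apply]
      ring
  obtain ⟨r, G, g, hr, hr1, hG, hg, hAg, hgG⟩ := exists_majorant_of_stable hA hh hu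
  refine exists_of_approx fun ε hε => ?_
  have hlim : Tendsto (fun k : ℕ => (‖φ‖ * r ^ k) ^ 2 * G) atTop (𝓝 0) := by
    simpa using (((tendsto_pow_atTop_nhds_zero_of_lt_one hr hr1).const_mul ‖φ‖).pow 2).mul_const G
  obtain ⟨k, hk⟩ := (hlim.eventually_lt_const hε).exists
  obtain ⟨b, l, hb, hbt⟩ := key k
  refine ⟨k, b, l, hb, ?_⟩
  filter_upwards [hgG] with N h2
  have h3 : ∀ t, φ (h (t + k + 1)) ^ 2 - b t ≤ (‖φ‖ * r ^ k) ^ 2 * g (t + 1) ^ 2 := fun t => by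
    rw [hbt, add_sub_cancel_left, ← mul_pow, ← sq_abs, mul_assoc]
    gcongr
    exact (φ.le_opNorm _).trans (by gcongr; exact hAg _ _)
  have h4 : 0 ≤ ∑ t ∈ Finset.range N, (φ (h (t + k + 1)) ^ 2 - b t) :=
    Finset.sum_nonneg fun t _ => by rw [hbt, add_sub_cancel_left]; positivity
  rw [abs_of_nonneg (by positivity)]
  calc (∑ t ∈ Finset.range N, (φ (h (t + k + 1)) ^ 2 - b t)) / N
      ≤ (∑ t ∈ Finset.range N, (‖φ‖ * r ^ k) ^ 2 * g (t + 1) ^ 2) / N := by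
        gcongr with t; exact h3 t
    _ = (‖φ‖ * r ^ k) ^ 2 * ((∑ t ∈ Finset.range N, g (t + 1) ^ 2) / N) := by
        rw [← Finset.mul_sum]; ring
    _ ≤ (‖φ‖ * r ^ k) ^ 2 * G := by gcongr
    _ ≤ ε := hk.le

end StableRecursion

/-! ### Strong law of large numbers for orthogonal sequences -/

/-- If the partial averages tend to zero along the squares, and the oscillation of the partial sums
between consecutive squares is negligible, then the averages tend to zero. -/
lemma hasCesaroMean_zero_of_squares {a : ℕ → ℝ}
    (h1 : Tendsto (fun k : ℕ => (∑ t ∈ Finset.range (k ^ 2), a t) / (k : ℝ) ^ 2) atTop (𝓝 0))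
    (h2 : Tendsto (fun k : ℕ => (∑ j ∈ Finset.range (2 * k + 1),
      (∑ t ∈ Finset.range j, a (k ^ 2 + t)) ^ 2) / (k : ℝ) ^ 4) atTop (𝓝 0)) :
    HasCesaroMean a 0 := by
  have hsq : Tendsto Nat.sqrt atTop atTop := by
    refine tendsto_atTop.2 fun b => ?_
    filter_upwards [eventually_ge_atTop (b ^ 2)] with N hN
    exact Nat.le_sqrt'.2 hN
  have h3 : Tendsto (fun k : ℕ => |(∑ t ∈ Finset.range (k ^ 2), a t) / (k : ℝ) ^ 2|
      + √((∑ j ∈ Finset.range (2 * k + 1),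
        (∑ t ∈ Finset.range j, a (k ^ 2 + t)) ^ 2) / (k : ℝ) ^ 4)) atTop (𝓝 0) := by
    simpa using h1.abs.add (h2.sqrt)
  refine squeeze_zero_norm' ?_ (h3.comp hsq)
  filter_upwards [eventually_ge_atTop 1] with N hN
  set k := Nat.sqrt N with hk
  have hk1 : 1 ≤ k := Nat.le_sqrt'.2 (by simpa using hN)
  have hkpos : (0 : ℝ) < (k : ℝ) ^ 2 := by positivity
  have hkN : k ^ 2 ≤ N := Nat.sqrt_le' N
  have hNk : N < (k + 1) ^ 2 := Nat.lt_succ_sqrt' N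
  have hkN' : (k : ℝ) ^ 2 ≤ N := by exact_mod_cast hkN
  clear_value k
  obtain ⟨j, rfl⟩ := Nat.exists_eq_add_of_le hkN
  have hj : j ∈ Finset.range (2 * k + 1) := by
    rw [Finset.mem_range]; nlinarith
  -- With `k = ⌊√N⌋` and `N = k² + j`, `j ≤ 2k`, the maximum over `j` is bounded by the ℓ² sum over
  -- all `j`.
  have h4 : |∑ t ∈ Finset.range j, a (k ^ 2 + t)| / (k : ℝ) ^ 2
      ≤ √((∑ j ∈ Finset.range (2 * k + 1),
        (∑ t ∈ Finset.range j, a (k ^ 2 + t)) ^ 2) / (k : ℝ) ^ 4) := by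
    refine Real.le_sqrt_of_sq_le ?_
    rw [div_pow, sq_abs, ← pow_mul]
    gcongr
    exact Finset.single_le_sum (f := fun j => (∑ t ∈ Finset.range j, a (k ^ 2 + t)) ^ 2)
      (fun i _ => sq_nonneg _) hj
  rw [Real.norm_eq_abs, abs_div, Nat.abs_cast, Function.comp_apply, ← hk, abs_div,
    abs_of_pos hkpos]
  refine le_trans ?_ (add_le_add_right h4 _)
  rw [← add_div, Finset.sum_range_add]
  gcongr
  exact abs_add_le _ _

section Probability

variable {Ω : Type*} {mΩ : MeasurableSpace Ω} {P : Measure Ω}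

/-- By Tonelli the series of the `f k` has finite integral, so it converges almost everywhere and
its terms tend to zero. -/
lemma ae_tendsto_zero_of_summable_integral {f : ℕ → Ω → ℝ} (hf : ∀ k ω, 0 ≤ f k ω)
    (hint : ∀ k, Integrable (f k) P) (hsum : Summable fun k => ∫ ω, f k ω ∂P) :
    ∀ᵐ ω ∂P, Tendsto (fun k => f k ω) atTop (𝓝 0) := by
  have h1 : ∫⁻ ω, ∑' k, ENNReal.ofReal (f k ω) ∂P ≠ ⊤ := by
    rw [lintegral_tsum fun k => (hint k).1.aemeasurable.ennreal_ofReal]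
    simp_rw [← ofReal_integral_eq_lintegral_ofReal (hint _) (Eventually.of_forall (hf _))]
    exact hsum.tsum_ofReal_ne_top
  filter_upwards [ae_lt_top' (AEMeasurable.tsum fun k =>
    (hint k).1.aemeasurable.ennreal_ofReal) h1] with ω hω
  have h2 := ENNReal.tendsto_toReal ENNReal.zero_ne_top |>.comp
    (ENNReal.tendsto_atTop_zero_of_tsum_ne_top hω.ne)
  simpa [Function.comp_def, ENNReal.toReal_ofReal (hf _ _)] using h2

lemma integral_sq_sum_le_of_orthogonal {X : ℕ → Ω → ℝ} {c : ℝ} (hX : ∀ t, MemLp (X t) 2 P)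
    (hc : ∀ t, ∫ ω, X t ω ^ 2 ∂P ≤ c)
    (horth : ∀ s t, s < t → ∫ ω, X s ω * X t ω ∂P = 0) (k j : ℕ) :
    ∫ ω, (∑ t ∈ Finset.range j, X (k + t) ω) ^ 2 ∂P ≤ j * c := by
  induction j with
  | zero => simp
  | succ j ih =>
    have hS : MemLp (fun ω => ∑ t ∈ Finset.range j, X (k + t) ω) 2 P :=
      memLp_finsetSum _ fun t _ => hX _
    have h1 : ∫ ω, (∑ t ∈ Finset.range j, X (k + t) ω) * X (k + j) ω ∂P = 0 := by
      simp_rw [Finset.sum_mul]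
      rw [integral_finsetSum _ fun t _ => show Integrable (fun ω => X (k + t) ω * X (k + j) ω) P from
        (hX _).integrable_mul (hX _)]
      refine Finset.sum_eq_zero fun t ht => horth _ _ ?_
      rw [Finset.mem_range] at ht
      omega
    simp_rw [Finset.sum_range_succ, add_sq, mul_assoc]
    have i1 := hS.integrable_sq
    have i2 := (hS.integrable_mul (hX (k + j))).const_mul 2
    have i3 := (hX (k + j)).integrable_sq
    simp only [Pi.mul_apply] at i2
    have i12 := i1.add i2
    simp only [Pi.add_def] at i12
    rw [integral_add i12 i3, integral_add i1 i2, integral_const_mul, h1]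
    push_cast
    linarith [hc (k + j)]

/-- **Strong law of large numbers** for an orthogonal sequence with bounded second moments. -/
theorem ae_hasCesaroMean_zero_of_orthogonal {X : ℕ → Ω → ℝ} {c : ℝ} (hX : ∀ t, MemLp (X t) 2 P)
    (hc : ∀ t, ∫ ω, X t ω ^ 2 ∂P ≤ c)
    (hort : ∀ s t, s < t → ∫ ω, X s ω * X t ω ∂P = 0) :
    ∀ᵐ ω ∂P, HasCesaroMean (fun t => X t ω) 0 := by
  have hc0 : 0 ≤ c := (integral_nonneg fun ω => sq_nonneg _).trans (hc 0)
  have hL : ∀ k j, MemLp (fun ω => ∑ t ∈ Finset.range j, X (k + t) ω) 2 P := fun k j =>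
    memLp_finsetSum _ fun t _ => hX _
  -- Common majorant of both expectations: `k² c / k⁴` along the squares, and at most `(2k + 1) (2k)
  -- c / k⁴ ≤ (3k)² c / k⁴` for the oscillation.
  have hs : Summable fun k : ℕ => 9 * c * (1 / (k : ℝ) ^ 2) :=
    (Real.summable_one_div_nat_pow.2 one_lt_two).mul_left _
  have h1 : ∀ᵐ ω ∂P, Tendsto (fun k : ℕ =>
      (∑ t ∈ Finset.range (k ^ 2), X (0 + t) ω) ^ 2 / (k : ℝ) ^ 4) atTop (𝓝 0) := by
    refine ae_tendsto_zero_of_summable_integral (fun k ω => by positivity)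
      (fun k => (hL 0 _).integrable_sq.div_const _)
      (hs.of_nonneg_of_le (fun k => integral_nonneg fun ω => by positivity) fun k => ?_)
    rw [integral_div]
    rcases Nat.eq_zero_or_pos k with rfl | hk
    · simp
    have hk' : (0 : ℝ) < k := by exact_mod_cast hk
    have := integral_sq_sum_le_of_orthogonal hX hc hort 0 (k ^ 2)
    push_cast at this
    rw [div_le_iff₀ (by positivity)]
    refine this.trans ?_
    have : 9 * c * (1 / (k : ℝ) ^ 2) * (k : ℝ) ^ 4 = 9 * ((k : ℝ) ^ 2 * c) := by
      field_simp
    rw [this]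
    nlinarith [mul_nonneg (sq_nonneg (k : ℝ)) hc0]
  have h2 : ∀ᵐ ω ∂P, Tendsto (fun k : ℕ => (∑ j ∈ Finset.range (2 * k + 1),
      (∑ t ∈ Finset.range j, X (k ^ 2 + t) ω) ^ 2) / (k : ℝ) ^ 4) atTop (𝓝 0) := by
    refine ae_tendsto_zero_of_summable_integral (fun k ω => by positivity)
      (fun k => (integrable_finsetSum _ fun j _ => (hL _ _).integrable_sq).div_const _)
      (hs.of_nonneg_of_le (fun k => integral_nonneg fun ω => by positivity) fun k => ?_)
    rw [integral_div, integral_finsetSum _ fun j _ => (hL _ _).integrable_sq]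
    rcases Nat.eq_zero_or_pos k with rfl | hk
    · simp
    have hk' : (1 : ℝ) ≤ k := by exact_mod_cast hk
    have h3 : ∑ j ∈ Finset.range (2 * k + 1), ∫ ω, (∑ t ∈ Finset.range j, X (k ^ 2 + t) ω) ^ 2 ∂P
        ≤ ∑ j ∈ Finset.range (2 * k + 1), (3 * k) * c := by
      refine Finset.sum_le_sum fun j hj =>
        (integral_sq_sum_le_of_orthogonal hX hc hort _ _).trans ?_
      have : j ≤ 2 * k := by rw [Finset.mem_range] at hj; omega
      have : (j : ℝ) ≤ 2 * k := by exact_mod_cast this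
      gcongr
      linarith
    rw [div_le_iff₀ (by positivity)]
    refine h3.trans ?_
    rw [Finset.sum_const, Finset.card_range, nsmul_eq_mul]
    have : 9 * c * (1 / (k : ℝ) ^ 2) * (k : ℝ) ^ 4 = (3 * k) * (3 * k * c) := by
      field_simp
      ring
    rw [this]
    push_cast
    gcongr
    linarith
  filter_upwards [h1, h2] with ω h1 h2
  refine hasCesaroMean_zero_of_squares ?_ h2
  have h3 := h1.sqrt
  rw [Real.sqrt_zero] at h3
  refine squeeze_zero_norm (fun k => le_of_eq ?_) h3
  rw [Real.norm_eq_abs, show (k : ℝ) ^ 4 = ((k : ℝ) ^ 2) ^ 2 by ring, ← div_pow, Real.sqrt_sq_eq_abs]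
  simp

end Probability

/-! ### Geometric decay from the spectral radius -/

section Stability

attribute [local instance] Matrix.linftyOpNormedRing Matrix.linftyOpNormedAlgebra

/-- Gelfand's formula yields `‖A ^ k‖ ≤ r ^ k` for large `k`, with any `r` strictly between the
spectral radius and `1`; the finitely many earlier powers go into `c`. -/
lemma Matrix.exists_norm_pow_le_of_spectralRadius_lt_one {n : ℕ} {A : Matrix (Fin n) (Fin n) ℂ}
    (hA : spectralRadius ℂ A < 1) : ∃ c r : ℝ, 0 ≤ c ∧ 0 ≤ r ∧ r < 1 ∧ ∀ k, ‖A ^ k‖ ≤ c * r ^ k := by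
  have : CompleteSpace (Matrix (Fin n) (Fin n) ℂ) := FiniteDimensional.complete ℂ _
  obtain ⟨r, hAr, hr1⟩ := ENNReal.lt_iff_exists_nnreal_btwn.1 hA
  have hr1' : r < 1 := by exact_mod_cast hr1
  have hr0 : 0 < r := by
    have := pos_of_gt hAr
    exact_mod_cast this
  have h1 := (spectrum.pow_nnnorm_pow_one_div_tendsto_nhds_spectralRadius A).eventually_lt_const hAr
  have h2 : ∀ᶠ k : ℕ in atTop, ‖A ^ k‖ ≤ (r : ℝ) ^ k := by
    filter_upwards [h1, eventually_ge_atTop 1] with k hk hk1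
    have hk0 : (0 : ℝ) < k := by exact_mod_cast hk1
    have h3 := ENNReal.rpow_le_rpow hk.le hk0.le
    rw [← ENNReal.rpow_mul, one_div_mul_cancel hk0.ne', ENNReal.rpow_one,
      ENNReal.rpow_natCast] at h3
    exact_mod_cast h3
  obtain ⟨k₀, hk₀⟩ := eventually_atTop.1 h2
  refine ⟨1 + ∑ k ∈ Finset.range k₀, ‖A ^ k‖ / (r : ℝ) ^ k, r, by positivity, r.2,
    by exact_mod_cast hr1', fun k => ?_⟩
  have hrk : (0 : ℝ) < (r : ℝ) ^ k := by positivity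
  rcases lt_or_ge k k₀ with h | h
  · rw [← div_le_iff₀ hrk]
    have := Finset.single_le_sum (f := fun k => ‖A ^ k‖ / (r : ℝ) ^ k)
      (fun i _ => by positivity) (Finset.mem_range.2 h)
    linarith
  · refine (hk₀ k h).trans (le_mul_of_one_le_left hrk.le ?_)
    have : 0 ≤ ∑ k ∈ Finset.range k₀, ‖A ^ k‖ / (r : ℝ) ^ k :=
      Finset.sum_nonneg fun i _ => by positivity
    linarith

lemma Matrix.abs_apply_le_linfty_opNorm_map {n : ℕ} (A : Matrix (Fin n) (Fin n) ℝ) (i j : Fin n) :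
    |A i j| ≤ ‖A.map (algebraMap ℝ ℂ)‖ := by
  have h1 : ‖(A.map (algebraMap ℝ ℂ)) i j‖₊ ≤ ∑ j, ‖(A.map (algebraMap ℝ ℂ)) i j‖₊ :=
    Finset.single_le_sum (f := fun j => ‖(A.map (algebraMap ℝ ℂ)) i j‖₊) (fun _ _ => zero_le)
      (Finset.mem_univ j)
  have h2 : ‖(A.map (algebraMap ℝ ℂ)) i j‖₊ ≤ ‖A.map (algebraMap ℝ ℂ)‖₊ := by
    rw [Matrix.linfty_opNNNorm_def]
    exact h1.trans (Finset.le_sup (f := fun i => ∑ j, ‖(A.map (algebraMap ℝ ℂ)) i j‖₊)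
      (Finset.mem_univ i))
  have h3 : ‖(A.map (algebraMap ℝ ℂ)) i j‖ ≤ ‖A.map (algebraMap ℝ ℂ)‖ := h2
  simpa using h3

lemma Matrix.norm_toEuclideanLin_apply_le {n : ℕ} (A : Matrix (Fin n) (Fin n) ℝ) {c : ℝ}
    (hc : 0 ≤ c) (hA : ∀ i j, |A i j| ≤ c) (v : EuclideanSpace ℝ (Fin n)) :
    ‖Matrix.toEuclideanLin A v‖ ≤ n * n * c * ‖v‖ := by
  have h1 : ∀ i, |(Matrix.toEuclideanLin A v) i| ≤ n * c * ‖v‖ := fun i => by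
    rw [Matrix.toLpLin_apply]
    simp only [Matrix.mulVec, dotProduct]
    refine (Finset.abs_sum_le_sum_abs _ _).trans ?_
    calc ∑ j, |A i j * v j| ≤ ∑ j : Fin n, c * ‖v‖ := by
          refine Finset.sum_le_sum fun j _ => ?_
          rw [abs_mul]
          gcongr
          · exact hA i j
          · exact PiLp.norm_apply_le v j
      _ = _ := by simp; ring
  have h2 := EuclideanSpace.basisFun (Fin n) ℝ |>.sum_repr (Matrix.toEuclideanLin A v)
  rw [← h2]
  refine (norm_sum_le _ _).trans ?_
  calc ∑ i, ‖((EuclideanSpace.basisFun (Fin n) ℝ).repr (Matrix.toEuclideanLin A v)).ofLp i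
        • (EuclideanSpace.basisFun (Fin n) ℝ) i‖ ≤ ∑ i : Fin n, n * c * ‖v‖ := by
        refine Finset.sum_le_sum fun i _ => ?_
        rw [norm_smul, OrthonormalBasis.norm_eq_one, mul_one]
        exact h1 i
    _ = _ := by simp; ring

/-- Decay of the complexified powers in the ℓ∞ operator norm passes through the entries to the real
Euclidean norm, at the cost of a factor `n * n` independent of `k`. -/
lemma Matrix.isGeometricallyStable_of_spectralRadius_lt_one {n : ℕ} {A : Matrix (Fin n) (Fin n) ℝ}
    (hA : spectralRadius ℂ (A.map (algebraMap ℝ ℂ)) < 1) :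
    IsGeometricallyStable (LinearMap.toContinuousLinearMap (Matrix.toEuclideanLin A)) := by
  obtain ⟨c, r, hc, hr, hr1, h⟩ := Matrix.exists_norm_pow_le_of_spectralRadius_lt_one hA
  refine ⟨n * n * c, r, by positivity, hr, hr1, fun k v => ?_⟩
  have h1 : (LinearMap.toContinuousLinearMap (Matrix.toEuclideanLin A) ^ k) v
      = Matrix.toEuclideanLin (A ^ k) v := by
    induction k with
    | zero => simp
    | succ k ih =>
      rw [pow_succ', pow_succ', mul_apply_eq_comp, ih, Matrix.toLpLin_mul_same]
      rfl
  rw [h1]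
  have h2 := Matrix.norm_toEuclideanLin_apply_le (A ^ k) (c := c * r ^ k) (by positivity)
    (fun i j => (Matrix.abs_apply_le_linfty_opNorm_map _ i j).trans (by
      rw [Matrix.map_pow]; exact h k)) v
  exact h2.trans (le_of_eq (by ring))

end Stability

/-! ### Empirical moments of Gaussian inputs and noise -/

section Gaussian

variable {Ω : Type*} {mΩ : MeasurableSpace Ω} {P : Measure Ω} {d : ℕ}
  {S : Matrix (Fin d) (Fin d) ℝ}

lemma measurable_euclidean_apply (k : Fin d) :
    Measurable fun x : EuclideanSpace ℝ (Fin d) => x k := by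
  fun_prop

section Coordinates

variable {X : Ω → EuclideanSpace ℝ (Fin d)} (hX : HasLaw X (multivariateGaussian 0 S) P)
include hX

lemma memLp_apply_of_hasLaw_multivariateGaussian (k : Fin d) : MemLp (fun ω => X ω k) 2 P := by
  have h1 : MemLp (fun x : EuclideanSpace ℝ (Fin d) => x k) 2 (multivariateGaussian 0 S) :=
    (IsGaussian.memLp_two_id (μ := multivariateGaussian 0 S)).continuousLinearMap_comp
      (EuclideanSpace.proj (𝕜 := ℝ) k)
  rw [← hX.map_eq] at h1
  exact h1.comp_of_map hX.aemeasurable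

lemma integral_apply_of_hasLaw_multivariateGaussian (k : Fin d) : ∫ ω, X ω k ∂P = 0 := by
  have h1 := hX.integral_comp (f := fun x : EuclideanSpace ℝ (Fin d) => x k) (by fun_prop)
  have h2 := (EuclideanSpace.proj (𝕜 := ℝ) k : EuclideanSpace ℝ (Fin d) →L[ℝ] ℝ).integral_comp_comm
    (IsGaussian.integrable_id (μ := multivariateGaussian 0 S))
  simp only [id, integral_id_multivariateGaussian] at h2
  exact h1.trans (h2.trans (by simp))

lemma integral_mul_apply_of_hasLaw_multivariateGaussian (hS : S.PosSemidef) (k l : Fin d) :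
    ∫ ω, X ω k * X ω l ∂P = S k l := by
  have h1 := hX.covariance_fun_comp (f := fun x : EuclideanSpace ℝ (Fin d) => x k)
    (g := fun x : EuclideanSpace ℝ (Fin d) => x l) (by fun_prop) (by fun_prop)
  rw [covariance_eval_multivariateGaussian hS, covariance] at h1
  simpa [integral_apply_of_hasLaw_multivariateGaussian hX] using h1

end Coordinates

/-- The second moments of an independent sequence of centered Gaussian vectors with common
covariance matrix `S` average to `S`. -/
lemma ae_hasCesaroMean_mul_apply {X : ℕ → Ω → EuclideanSpace ℝ (Fin d)} (hS : S.PosSemidef)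
    (hX : ∀ t, HasLaw (X t) (multivariateGaussian 0 S) P) (hind : iIndepFun X P) (k l : Fin d) :
    ∀ᵐ ω ∂P, HasCesaroMean (fun t => X t ω k * X t ω l) (S k l) := by
  have hm : Measurable fun x : EuclideanSpace ℝ (Fin d) => x k * x l := by fun_prop
  have h1 := strong_law_ae_real (fun t ω => X t ω k * X t ω l)
    ((memLp_apply_of_hasLaw_multivariateGaussian (hX 0) k).integrable_mul
      (memLp_apply_of_hasLaw_multivariateGaussian (hX 0) l))
    (fun s t hst => (hind.indepFun hst).comp hm hm)
    (fun t => ((hX t).identDistrib (hX 0)).comp hm)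
  rw [integral_mul_apply_of_hasLaw_multivariateGaussian (hX 0) hS] at h1
  exact h1

lemma memLp_two_mul_of_indepFun {X Y : Ω → ℝ} (hX : MemLp X 2 P) (hY : MemLp Y 2 P)
    (hXY : IndepFun X Y P) : MemLp (fun ω => X ω * Y ω) 2 P := by
  refine (memLp_two_iff_integrable_sq (hX.1.mul hY.1)).2 ?_
  have h1 : IndepFun (fun ω => X ω ^ 2) (fun ω => Y ω ^ 2) P :=
    hXY.comp (φ := fun x : ℝ => x ^ 2) (ψ := fun x : ℝ => x ^ 2) (by fun_prop) (by fun_prop)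
  refine (h1.integrable_mul hX.integrable_sq hY.integrable_sq).congr (ae_of_all _ fun ω => ?_)
  simp [mul_pow]

lemma integral_sq_mul_of_indepFun {X Y : Ω → ℝ} (hX : MemLp X 2 P) (hY : MemLp Y 2 P)
    (hXY : IndepFun X Y P) :
    ∫ ω, (X ω * Y ω) ^ 2 ∂P = (∫ ω, X ω ^ 2 ∂P) * ∫ ω, Y ω ^ 2 ∂P := by
  have h1 : IndepFun (fun ω => X ω ^ 2) (fun ω => Y ω ^ 2) P :=
    hXY.comp (φ := fun x : ℝ => x ^ 2) (ψ := fun x : ℝ => x ^ 2) (by fun_prop) (by fun_prop)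
  simp_rw [mul_pow]
  exact h1.integral_fun_mul_eq_mul_integral (hX.1.pow 2) (hY.1.pow 2)

/-- Independent centered Gaussian vectors are asymptotically uncorrelated at positive lags. -/
lemma ae_hasCesaroMean_lag_mul_apply {X : ℕ → Ω → EuclideanSpace ℝ (Fin d)} (hS : S.PosSemidef)
    (hX : ∀ t, HasLaw (X t) (multivariateGaussian 0 S) P) (hind : iIndepFun X P) {s : ℕ}
    (hs : s ≠ 0) (k l : Fin d) :
    ∀ᵐ ω ∂P, HasCesaroMean (fun t => X (t + s) ω k * X t ω l) 0 := by
  have hL := fun t => memLp_apply_of_hasLaw_multivariateGaussian (hX t)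
  have hi : ∀ t, IndepFun (fun ω => X (t + s) ω k) (fun ω => X t ω l) P := fun t =>
    (hind.indepFun (by omega : t + s ≠ t)).comp (measurable_euclidean_apply k)
      (measurable_euclidean_apply l)
  refine ae_hasCesaroMean_zero_of_orthogonal (c := S k k * S l l)
    (fun t => memLp_two_mul_of_indepFun (hL _ _) (hL _ _) (hi t)) (fun t => ?_)
    (fun t t' htt' => ?_)
  · rw [integral_sq_mul_of_indepFun (hL _ _) (hL _ _) (hi t)]
    simp_rw [sq]
    rw [integral_mul_apply_of_hasLaw_multivariateGaussian (hX _) hS,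
      integral_mul_apply_of_hasLaw_multivariateGaussian (hX _) hS]
  · have h1 := hind.indepFun_finset₀ {t, t + s, t'} {t' + s} (by simp; omega)
      (fun i => (hX i).aemeasurable)
    have h2 : IndepFun (fun ω => X (t + s) ω k * X t ω l * X t' ω l) (fun ω => X (t' + s) ω k) P :=
      h1.comp (φ := fun f : ({t, t + s, t'} : Finset ℕ) → EuclideanSpace ℝ (Fin d) =>
          f ⟨t + s, by simp⟩ k * f ⟨t, by simp⟩ l * f ⟨t', by simp⟩ l)
        (ψ := fun f : ({t' + s} : Finset ℕ) → EuclideanSpace ℝ (Fin d) => f ⟨t' + s, by simp⟩ k)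
        (by fun_prop) (by fun_prop)
    have h3 := h2.integral_fun_mul_eq_mul_integral
      (((hL (t + s) k).1.mul (hL t l).1).mul (hL t' l).1) (hL (t' + s) k).1
    rw [integral_apply_of_hasLaw_multivariateGaussian (hX _), mul_zero] at h3
    rw [← h3]
    congr 1 with ω
    ring

/-- A process of centered Gaussian vectors is asymptotically uncorrelated with an independent
sequence of independent centered Gaussian vectors, whatever its own dependence structure. -/
lemma ae_hasCesaroMean_mul_apply_of_indepFun {d' : ℕ} {R : Matrix (Fin d') (Fin d') ℝ}
    {X : ℕ → Ω → EuclideanSpace ℝ (Fin d)} {Y : ℕ → Ω → EuclideanSpace ℝ (Fin d')}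
    (hS : S.PosSemidef) (hR : R.PosSemidef)
    (hX : ∀ t, HasLaw (X t) (multivariateGaussian 0 S) P) (hind : iIndepFun X P)
    (hY : ∀ t, HasLaw (Y t) (multivariateGaussian 0 R) P)
    (hXY : IndepFun (fun ω t => X t ω) (fun ω t => Y t ω) P) (s : ℕ) (k : Fin d') (l : Fin d) :
    ∀ᵐ ω ∂P, HasCesaroMean (fun t => Y (t + s) ω k * X t ω l) 0 := by
  have hLX := fun t => memLp_apply_of_hasLaw_multivariateGaussian (hX t)
  have hLY := fun t => memLp_apply_of_hasLaw_multivariateGaussian (hY t)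
  have hi : ∀ t, IndepFun (fun ω => Y (t + s) ω k) (fun ω => X t ω l) P := fun t =>
    hXY.symm.comp (φ := fun f : ℕ → EuclideanSpace ℝ (Fin d') => f (t + s) k)
      (ψ := fun f : ℕ → EuclideanSpace ℝ (Fin d) => f t l)
      (by fun_prop) (by fun_prop)
  refine ae_hasCesaroMean_zero_of_orthogonal (c := R k k * S l l)
    (fun t => memLp_two_mul_of_indepFun (hLY _ _) (hLX _ _) (hi t)) (fun t => ?_)
    (fun t t' htt' => ?_)
  · rw [integral_sq_mul_of_indepFun (hLY _ _) (hLX _ _) (hi t)]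
    simp_rw [sq]
    rw [integral_mul_apply_of_hasLaw_multivariateGaussian (hX _) hS,
      integral_mul_apply_of_hasLaw_multivariateGaussian (hY _) hR]
  -- The expectation factors as `E[Y Y'] E[X X']`, and the second factor vanishes whatever the
  -- dependence within `Y`.
  · have h1 : IndepFun (fun ω => Y (t + s) ω k * Y (t' + s) ω k)
        (fun ω => X t ω l * X t' ω l) P :=
      hXY.symm.comp (φ := fun f : ℕ → EuclideanSpace ℝ (Fin d') => f (t + s) k * f (t' + s) k)
        (ψ := fun f : ℕ → EuclideanSpace ℝ (Fin d) => f t l * f t' l)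
        (by fun_prop) (by fun_prop)
    have h2 : IndepFun (fun ω => X t ω l) (fun ω => X t' ω l) P :=
      (hind.indepFun htt'.ne).comp (measurable_euclidean_apply l) (measurable_euclidean_apply l)
    have h3 := h2.integral_fun_mul_eq_mul_integral (hLX t l).1 (hLX t' l).1
    have h4 := h1.integral_fun_mul_eq_mul_integral
      ((hLY (t + s) k).1.mul (hLY (t' + s) k).1) ((hLX t l).1.mul (hLX t' l).1)
    rw [integral_apply_of_hasLaw_multivariateGaussian (hX _), zero_mul] at h3
    rw [h3, mul_zero] at h4
    rw [← h4]
    congr 1 with ω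
    ring

end Gaussian

/-! ### Decomposition of the output and reduction to excess cost -/

lemma Matrix.toEuclideanLin_apply_eq_sum {ι κ : Type*} [Fintype ι] [DecidableEq ι]
    (M : Matrix κ ι ℝ) (v : EuclideanSpace ℝ ι) (i : κ) :
    (Matrix.toEuclideanLin M v) i = ∑ a, M i a * v a := by
  rw [Matrix.toLpLin_apply]
  rfl

/-- The state `k` steps ahead: the response to the last `k` inputs plus the propagated state. -/
lemma toEuclideanLin_hiddenState_add {n m p : ℕ} (A : Matrix (Fin n) (Fin n) ℝ)
    (B : Matrix (Fin n) (Fin m) ℝ) (C : Matrix (Fin p) (Fin n) ℝ) (h₀ : EuclideanSpace ℝ (Fin n))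
    (u : ℕ → EuclideanSpace ℝ (Fin m)) (k t : ℕ) :
    Matrix.toEuclideanLin C (hiddenState A B h₀ u (t + k + 1))
      = ∑ j : Fin k, Matrix.toEuclideanLin (C * A ^ (j : ℕ) * B) (u (t + (k - j)))
        + Matrix.toEuclideanLin (C * A ^ k) (hiddenState A B h₀ u (t + 1)) := by
  induction k generalizing t with
  | zero => simp
  | succ k ih =>
    rw [show t + (k + 1) + 1 = (t + 1) + k + 1 by ring, ih (t + 1), hiddenState,
      Fin.sum_univ_castSucc, map_add]
    have h1 : Matrix.toEuclideanLin (C * A ^ k)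
          (Matrix.toEuclideanLin A (hiddenState A B h₀ u (t + 1)))
        = Matrix.toEuclideanLin (C * A ^ (k + 1)) (hiddenState A B h₀ u (t + 1)) := by
      rw [pow_succ, ← Matrix.mul_assoc, Matrix.toLpLin_mul_same 2 (C * A ^ k) A]
      rfl
    have h2 : Matrix.toEuclideanLin (C * A ^ k) (Matrix.toEuclideanLin B (u (t + 1)))
        = Matrix.toEuclideanLin (C * A ^ k * B) (u (t + 1)) := by
      rw [Matrix.toLpLin_mul_same 2 (C * A ^ k) B]
      rfl
    rw [h1, h2]
    have h3 : ∀ j : Fin k, t + 1 + (k - (j : ℕ)) = t + (k + 1 - j) := fun j => by omega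
    simp only [h3, Fin.val_castSucc, Fin.val_last, show k + 1 - k = 1 by omega]
    abel

lemma regressor_add_apply {m : ℕ} (T : ℕ) (u : ℕ → EuclideanSpace ℝ (Fin m)) (t : ℕ)
    (a : Fin T × Fin m) : regressor T u (t + T) a = u (t + (T - a.1)) a.2 := by
  have h1 : (a.1 : ℕ) < t + T := by omega
  have h2 : t + T - (a.1 : ℕ) = t + (T - a.1) := by omega
  simp [regressor, h1, h2]

/-- Once the window of the regressor is full, the output is the response of the truncated Markov
parameters plus the unmodelled hidden state and the noise. -/
lemma systemOutput_add_eq {n m p : ℕ} (A : Matrix (Fin n) (Fin n) ℝ)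
    (B : Matrix (Fin n) (Fin m) ℝ) (C : Matrix (Fin p) (Fin n) ℝ) (D : Matrix (Fin p) (Fin m) ℝ)
    (h₀ : EuclideanSpace ℝ (Fin n)) (u : ℕ → EuclideanSpace ℝ (Fin m))
    (ζ : ℕ → EuclideanSpace ℝ (Fin p)) {T : ℕ} (hT : 1 ≤ T) (t : ℕ) :
    systemOutput A B C D h₀ u ζ (t + T)
      = Matrix.toEuclideanLin (truncatedMarkov A B C D T) (regressor T u (t + T))
        + (Matrix.toEuclideanLin (C * A ^ (T - 1)) (hiddenState A B h₀ u (t + 1)) + ζ (t + T)) := by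
  obtain ⟨k, rfl⟩ := Nat.exists_eq_add_of_le' hT
  have h1 : Matrix.toEuclideanLin (truncatedMarkov A B C D (k + 1)) (regressor (k + 1) u (t + (k + 1)))
      = Matrix.toEuclideanLin D (u (t + (k + 1)))
        + ∑ j : Fin k, Matrix.toEuclideanLin (C * A ^ (j : ℕ) * B) (u (t + (k - j))) := by
    ext i
    simp only [Matrix.toEuclideanLin_apply_eq_sum, PiLp.add_apply, WithLp.ofLp_sum,
      Finset.sum_apply, regressor_add_apply, truncatedMarkov, Matrix.of_apply]
    rw [Fintype.sum_prod_type, Fin.sum_univ_succ]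
    simp [markovParameter]
  rw [h1, systemOutput, ← add_assoc t k 1, toEuclideanLin_hiddenState_add, Nat.add_sub_cancel]
  abel

/-- Shifting by `T` discards the transient with zero-padded regressors, where the decomposition of
the output is not available; averages do not see it. -/
lemma tendsto_regressionCost_iff {p : ℕ} {ι : Type*} [Fintype ι] [DecidableEq ι]
    (y : ℕ → EuclideanSpace ℝ (Fin p)) (x : ℕ → EuclideanSpace ℝ ι) (M : Matrix (Fin p) ι ℝ)
    (T : ℕ) (c : ℝ) :
    Tendsto (regressionCost y x M) atTop (𝓝 c) ↔ HasCesaroMean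
      (fun t => ‖y (t + T) - Matrix.toEuclideanLin M (x (t + T))‖ ^ 2) (2 * c) := by
  rw [HasCesaroMean.shift_iff (fun t => ‖y t - Matrix.toEuclideanLin M (x t)‖ ^ 2) (2 * c) T,
    ← HasCesaroMean.shift_iff _ _ 1]
  have h1 : regressionCost y x M = fun N : ℕ => 1 / 2 *
      ((∑ t ∈ Finset.range N, ‖y (t + 1) - Matrix.toEuclideanLin M (x (t + 1))‖ ^ 2) / N) := by
    ext N
    rw [regressionCost, Finset.sum_bij (s := Finset.Icc 1 N) (t := Finset.range N)
      (g := fun t => ‖y (t + 1) - Matrix.toEuclideanLin M (x (t + 1))‖ ^ 2) (fun t _ => t - 1)]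
    · ring
    · intro t ht
      simp only [Finset.mem_Icc, Finset.mem_range] at *
      omega
    · intro t ht t' ht' h
      simp only [Finset.mem_Icc] at *
      omega
    · intro t ht
      exact ⟨t + 1, by simp only [Finset.mem_Icc, Finset.mem_range] at *; omega, by simp⟩
    · intro t ht
      rw [Nat.sub_add_cancel (Finset.mem_Icc.1 ht).1]
  rw [h1]
  constructor
  · intro h
    refine (h.const_mul 2).congr fun N => by ring
  · intro h
    have := (show Tendsto _ _ _ from h).const_mul (1 / 2)
    rwa [one_div, inv_mul_cancel_left₀ two_ne_zero, ← one_div] at this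

/-- If the excess cost over `Θ` has a limit which is positive away from `Θ`, then `Θ` is the unique
minimizer of the infinite-horizon cost as soon as the latter exists. -/
lemma isRegressionSolution_iff_of_excess {p : ℕ} {ι : Type*} [Fintype ι] [DecidableEq ι]
    {y : ℕ → EuclideanSpace ℝ (Fin p)} {x : ℕ → EuclideanSpace ℝ ι} {Θ : Matrix (Fin p) ι ℝ}
    {T : ℕ} {q : Matrix (Fin p) ι ℝ → ℝ} (hq : ∀ M, M ≠ Θ → 0 < q M)
    (hexc : ∀ M, HasCesaroMean (fun t => ‖y (t + T) - Matrix.toEuclideanLin M (x (t + T))‖ ^ 2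
      - ‖y (t + T) - Matrix.toEuclideanLin Θ (x (t + T))‖ ^ 2) (q M))
    {c : ℝ} (hc : Tendsto (regressionCost y x Θ) atTop (𝓝 c)) (M : Matrix (Fin p) ι ℝ) :
    IsRegressionSolution y x M ↔ M = Θ := by
  have hΘ := (tendsto_regressionCost_iff y x Θ T c).1 hc
  have hqΘ : q Θ = 0 := (hexc Θ).unique (by simpa using HasCesaroMean.zero)
  -- Convergence at `Θ` alone forces convergence at every `M`, because the excess always converges.
  have hJ : ∀ M, Tendsto (regressionCost y x M) atTop (𝓝 (c + q M / 2)) := fun M => by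
    rw [tendsto_regressionCost_iff y x M T]
    have := (hexc M).add hΘ
    simp only [sub_add_cancel] at this
    convert! this using 1
    ring
  constructor
  · rintro ⟨J, hJ', hmin⟩
    by_contra hM
    have h1 : J M ≤ J Θ := hmin (Set.mem_univ Θ)
    rw [tendsto_nhds_unique (hJ' M) (hJ M), tendsto_nhds_unique (hJ' Θ) (hJ Θ)] at h1
    linarith [hq M hM]
  · rintro rfl
    refine ⟨_, hJ, fun M' _ => ?_⟩
    change c + q M / 2 ≤ c + q M' / 2
    rcases eq_or_ne M' M with rfl | h
    · exact le_rfl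
    · linarith [hq M' h]

lemma ContinuousLinearMap.apply_eq_sum_euclidean {m : ℕ} (ψ : EuclideanSpace ℝ (Fin m) →L[ℝ] ℝ)
    (v : EuclideanSpace ℝ (Fin m)) : ψ v = ∑ k, ψ (EuclideanSpace.single k 1) * v k := by
  conv_lhs => rw [← (EuclideanSpace.basisFun (Fin m) ℝ).sum_repr v]
  simp [mul_comm]

open Kronecker in
/-- The limiting second moment of the regressor is positive definite. -/
lemma posDef_one_kronecker {m : ℕ} (T : ℕ) {S : Matrix (Fin m) (Fin m) ℝ} (hS : S.PosDef) :
    ((1 : Matrix (Fin T) (Fin T) ℝ) ⊗ₖ S).PosDef :=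
  Matrix.PosDef.one.kronecker hS

/-! ### Deterministic consequences of empirical whiteness -/

/-- The inputs `u` have the empirical second moments of white noise with covariance matrix `S`. -/
structure IsEmpiricallyWhite {m : ℕ} (u : ℕ → EuclideanSpace ℝ (Fin m))
    (S : Matrix (Fin m) (Fin m) ℝ) : Prop where
  mean_mul : ∀ k l, HasCesaroMean (fun t => u t k * u t l) (S k l)
  mean_lag : ∀ s, s ≠ 0 → ∀ k l, HasCesaroMean (fun t => u (t + s) k * u t l) 0

namespace IsEmpiricallyWhite

open HasCesaroMean

variable {m : ℕ} {u : ℕ → EuclideanSpace ℝ (Fin m)} {S : Matrix (Fin m) (Fin m) ℝ}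

lemma norm_sq (hu : IsEmpiricallyWhite u S) :
    HasCesaroMean (fun t => ‖u t‖ ^ 2) (∑ k, S k k) := by
  simp_rw [EuclideanSpace.real_norm_sq_eq, sq]
  exact HasCesaroMean.sum _ fun k _ => hu.mean_mul k k

lemma apply_sq (hu : IsEmpiricallyWhite u S) (ψ : EuclideanSpace ℝ (Fin m) →L[ℝ] ℝ) :
    ∃ l, HasCesaroMean (fun t => ψ (u t) ^ 2) l := by
  have h1 := HasCesaroMean.sum Finset.univ fun k _ => HasCesaroMean.sum Finset.univ fun l _ =>
    (hu.mean_mul k l).const_mul (ψ (EuclideanSpace.single k 1) * ψ (EuclideanSpace.single l 1))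
  refine ⟨_, (congrArg (HasCesaroMean · _) (funext fun t => ?_)).mp h1⟩
  rw [ψ.apply_eq_sum_euclidean, sq, Finset.sum_mul_sum]
  exact Finset.sum_congr rfl fun k _ => Finset.sum_congr rfl fun l _ => by ring

lemma mul_apply_of_forall {m : ℕ} {u : ℕ → EuclideanSpace ℝ (Fin m)} {z : ℕ → ℝ}
    (h : ∀ l, HasCesaroMean (fun t => z t * u t l) 0) (ψ : EuclideanSpace ℝ (Fin m) →L[ℝ] ℝ) :
    HasCesaroMean (fun t => z t * ψ (u t)) 0 := by
  have h1 := HasCesaroMean.sum Finset.univ fun l _ =>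
    (h l).const_mul (ψ (EuclideanSpace.single l 1))
  simp only [mul_zero, Finset.sum_const_zero] at h1
  refine (congrArg (HasCesaroMean · 0) (funext fun t => ?_)).mp h1
  rw [ψ.apply_eq_sum_euclidean, Finset.mul_sum]
  exact Finset.sum_congr rfl fun l _ => by ring

open Kronecker in
-- Distinct blocks of the window are inputs at a fixed nonzero lag, so only the diagonal blocks
-- survive. The older input serves as base time.
lemma regressor_mul (hu : IsEmpiricallyWhite u S) {T : ℕ} (a b : Fin T × Fin m) :
    HasCesaroMean (fun t => regressor T u (t + T) a * regressor T u (t + T) b)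
      (((1 : Matrix (Fin T) (Fin T) ℝ) ⊗ₖ S) a b) := by
  have hlt : ∀ (j j' : Fin T) (k l : Fin m), j < j' →
      HasCesaroMean (fun t => u (t + (T - j)) k * u (t + (T - j')) l) 0 := fun j j' k l hj => by
    have hj' : (j : ℕ) < j' := hj
    have h1 := (shift_iff _ _ (T - j')).2 (hu.mean_lag (j' - j) (by omega) k l)
    have h2 : ∀ t, t + (T - (j' : ℕ)) + (j' - j) = t + (T - j) := fun t => by omega
    simpa only [h2] using h1
  obtain ⟨j, k⟩ := a
  obtain ⟨j', l⟩ := b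
  simp only [regressor_add_apply, Matrix.kroneckerMap_apply, Matrix.one_apply]
  rcases lt_trichotomy j j' with h | h | h
  · rw [if_neg h.ne, zero_mul]
    exact hlt _ _ _ _ h
  · subst h
    rw [if_pos rfl, one_mul]
    exact (shift_iff (fun t => u t k * u t l) _ _).2 (hu.mean_mul k l)
  · rw [if_neg h.ne', zero_mul]
    simpa only [mul_comm] using hlt _ _ l k h

section State

variable {n : ℕ} {A : Matrix (Fin n) (Fin n) ℝ} {B : Matrix (Fin n) (Fin m) ℝ}
  {h₀ : EuclideanSpace ℝ (Fin n)}

lemma hiddenState_succ_eq (t : ℕ) : hiddenState A B h₀ u (t + 1)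
    = LinearMap.toContinuousLinearMap (Matrix.toEuclideanLin A) (hiddenState A B h₀ u t)
      + LinearMap.toContinuousLinearMap (Matrix.toEuclideanLin B) (u t) := rfl

variable (hA : spectralRadius ℂ (A.map (algebraMap ℝ ℂ)) < 1)
include hA

/-- The state at time `t + 1` is built from `h₀` and inputs up to time `t`, so `s ≠ 0` makes `u (t +
s)` a future input. -/
lemma lag_mul_state (hu : IsEmpiricallyWhite u S) {s : ℕ} (hs : s ≠ 0) (k : Fin m)
    (φ : EuclideanSpace ℝ (Fin n) →L[ℝ] ℝ) :
    HasCesaroMean (fun t => u (t + s) k * φ (hiddenState A B h₀ u (t + 1))) 0 :=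
  hasCesaroMean_mul_state (z := fun t => u t k) (q' := S k k)
    (Matrix.isGeometricallyStable_of_spectralRadius_lt_one hA)
    hiddenState_succ_eq hu.norm_sq (by simpa only [sq] using hu.mean_mul k k)
    (fun s' hs' ψ => mul_apply_of_forall (fun l => hu.mean_lag s' (by omega) k l) ψ) φ

lemma exists_state_sq (hu : IsEmpiricallyWhite u S) (φ : EuclideanSpace ℝ (Fin n) →L[ℝ] ℝ) :
    ∃ l, HasCesaroMean (fun t => φ (hiddenState A B h₀ u (t + 1)) ^ 2) l := by
  refine exists_hasCesaroMean_sq_state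
    (Matrix.isGeometricallyStable_of_spectralRadius_lt_one hA)
    hiddenState_succ_eq hu.norm_sq hu.apply_sq (fun φ ψ => ?_) φ
  have h1 := HasCesaroMean.sum Finset.univ fun k _ =>
    (hu.lag_mul_state (B := B) (h₀ := h₀) hA one_ne_zero k φ).const_mul
      (ψ (EuclideanSpace.single k 1))
  simp only [mul_zero, Finset.sum_const_zero] at h1
  refine (congrArg (HasCesaroMean · 0) (funext fun t => ?_)).mp h1
  rw [ψ.apply_eq_sum_euclidean, Finset.mul_sum]
  exact Finset.sum_congr rfl fun l _ => by ring

lemma noise_mul_state (hu : IsEmpiricallyWhite u S) {ζ : ℕ → ℝ} {q : ℝ}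
    (hζu : ∀ s l, HasCesaroMean (fun t => ζ (t + s) * u t l) 0)
    (hζ : HasCesaroMean (fun t => ζ t ^ 2) q) (s : ℕ) (φ : EuclideanSpace ℝ (Fin n) →L[ℝ] ℝ) :
    HasCesaroMean (fun t => ζ (t + s) * φ (hiddenState A B h₀ u (t + 1))) 0 :=
  hasCesaroMean_mul_state (Matrix.isGeometricallyStable_of_spectralRadius_lt_one hA)
    hiddenState_succ_eq hu.norm_sq hζ
    (fun s' _ ψ => mul_apply_of_forall (fun l => hζu s' l) ψ) φ

end State

open Kronecker in
/-- Adding a linear function of the regressor to an error sequence which is asymptotically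
uncorrelated with it raises the mean square by a quadratic form. -/
lemma excess (hu : IsEmpiricallyWhite u S) {T : ℕ} {e : ℕ → ℝ}
    (he : ∀ a, HasCesaroMean (fun t => regressor T u (t + T) a * e t) 0) (w : Fin T × Fin m → ℝ) :
    HasCesaroMean (fun t => ((∑ a, w a * regressor T u (t + T) a) + e t) ^ 2 - e t ^ 2)
      (w ⬝ᵥ (((1 : Matrix (Fin T) (Fin T) ℝ) ⊗ₖ S).mulVec w)) := by
  have h1 := HasCesaroMean.sum Finset.univ fun a _ => HasCesaroMean.sum Finset.univ fun b _ =>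
    (hu.regressor_mul a b).const_mul (w a * w b)
  have h2 := HasCesaroMean.sum Finset.univ fun a _ => (he a).const_mul (2 * w a)
  simp only [mul_zero, Finset.sum_const_zero] at h2
  have h3 := h1.add h2
  rw [add_zero] at h3
  convert! h3 using 1
  · ext t
    rw [add_sq, sq (∑ a, w a * regressor T u (t + T) a), Finset.sum_mul_sum, add_sub_cancel_right,
      Finset.mul_sum, Finset.sum_mul]
    congr 1
    · exact Finset.sum_congr rfl fun k _ => Finset.sum_congr rfl fun l _ => by ring
    · exact Finset.sum_congr rfl fun k _ => by ring
  · simp only [dotProduct, Matrix.mulVec, Finset.mul_sum]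
    exact Finset.sum_congr rfl fun k _ => Finset.sum_congr rfl fun l _ => by ring

end IsEmpiricallyWhite

/-! ### The regression along one sample path -/

section Regression

open HasCesaroMean

variable {n m p : ℕ} {A : Matrix (Fin n) (Fin n) ℝ} {B : Matrix (Fin n) (Fin m) ℝ}
  {C : Matrix (Fin p) (Fin n) ℝ} {D : Matrix (Fin p) (Fin m) ℝ}
  {h₀ : EuclideanSpace ℝ (Fin n)} {u : ℕ → EuclideanSpace ℝ (Fin m)}
  {ζ : ℕ → EuclideanSpace ℝ (Fin p)} {S : Matrix (Fin m) (Fin m) ℝ}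
  {T : ℕ}

/-- The part of row `i` of the output that the regression does not model is a linear function of
the hidden state. -/
noncomputable def unmodelledFunctional (A : Matrix (Fin n) (Fin n) ℝ)
    (C : Matrix (Fin p) (Fin n) ℝ) (T : ℕ) (i : Fin p) : EuclideanSpace ℝ (Fin n) →L[ℝ] ℝ :=
  EuclideanSpace.proj (𝕜 := ℝ) i ∘L
    LinearMap.toContinuousLinearMap (Matrix.toEuclideanLin (C * A ^ (T - 1)))

lemma norm_sq_residual (hT : 1 ≤ T) (M : Matrix (Fin p) (Fin T × Fin m) ℝ) (t : ℕ) :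
    ‖systemOutput A B C D h₀ u ζ (t + T) - Matrix.toEuclideanLin M (regressor T u (t + T))‖ ^ 2
      = ∑ i, ((∑ a, (truncatedMarkov A B C D T - M) i a * regressor T u (t + T) a)
        + (unmodelledFunctional A C T i (hiddenState A B h₀ u (t + 1)) + ζ (t + T) i)) ^ 2 := by
  rw [EuclideanSpace.real_norm_sq_eq]
  refine Finset.sum_congr rfl fun i _ => ?_
  rw [systemOutput_add_eq A B C D h₀ u ζ hT, PiLp.sub_apply, PiLp.add_apply, PiLp.add_apply,
    Matrix.toEuclideanLin_apply_eq_sum, Matrix.toEuclideanLin_apply_eq_sum M]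
  simp only [Matrix.sub_apply, sub_mul, Finset.sum_sub_distrib]
  have h1 : unmodelledFunctional A C T i (hiddenState A B h₀ u (t + 1))
      = (Matrix.toEuclideanLin (C * A ^ (T - 1)) (hiddenState A B h₀ u (t + 1))) i := rfl
  rw [h1]
  ring

variable (hT : 1 ≤ T) (hA : spectralRadius ℂ (A.map (algebraMap ℝ ℂ)) < 1)
  (hu : IsEmpiricallyWhite u S)
  (hζu : ∀ s k l, HasCesaroMean (fun t => ζ (t + s) k * u t l) 0)
include hT hA hu hζu

/-- For empirically white inputs, uncorrelated with the noise, the truncated Markov parameters are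
the only solution of the regression as soon as their infinite-horizon cost exists. -/
theorem isRegressionSolution_iff_eq_truncatedMarkov (hS : S.PosDef) {c : ℝ}
    (hc : Tendsto (regressionCost (systemOutput A B C D h₀ u ζ) (regressor T u)
      (truncatedMarkov A B C D T)) atTop (𝓝 c)) (M : Matrix (Fin p) (Fin T × Fin m) ℝ) :
    IsRegressionSolution (systemOutput A B C D h₀ u ζ) (regressor T u) M ↔
      M = truncatedMarkov A B C D T := by
  have hpd := posDef_one_kronecker T hS
  -- Block `a.1` of the window is the input at time `t + (T - a.1)`, strictly later than every input
  -- in the state at `t + 1`.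
  have he : ∀ i a, HasCesaroMean (fun t => regressor T u (t + T) a
      * (unmodelledFunctional A C T i (hiddenState A B h₀ u (t + 1)) + ζ (t + T) i)) 0 := by
    intro i a
    have h1 := hu.lag_mul_state (B := B) (h₀ := h₀) hA (s := T - a.1) (by omega) a.2
      (unmodelledFunctional A C T i)
    have h2 := (shift_iff _ _ (T - a.1)).2 (hζu a.1 i a.2)
    have h3 : ∀ t, t + (T - (a.1 : ℕ)) + a.1 = t + T := fun t => by omega
    simp only [h3] at h2
    have h4 := h1.add h2
    rw [add_zero] at h4
    simp only [regressor_add_apply]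
    refine (congrArg (HasCesaroMean · 0) (funext fun t => ?_)).mp h4
    ring
  refine isRegressionSolution_iff_of_excess (T := T) (Θ := truncatedMarkov A B C D T)
    (q := fun M => ∑ i, (truncatedMarkov A B C D T - M) i ⬝ᵥ
      (Matrix.kroneckerMap (· * ·) (1 : Matrix (Fin T) (Fin T) ℝ) S).mulVec
        ((truncatedMarkov A B C D T - M) i)) (fun M hM => ?_) (fun M => ?_) hc M
  · have h0 : truncatedMarkov A B C D T - M ≠ 0 := sub_ne_zero.2 hM.symm
    obtain ⟨i, hi⟩ := Function.ne_iff.1 h0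
    -- The form acts row by row, and `M ≠ Θ_T` differs in some row.
    refine Finset.sum_pos' (fun i _ => ?_) ⟨i, Finset.mem_univ i, ?_⟩
    · simpa using hpd.posSemidef.dotProduct_mulVec_nonneg ((truncatedMarkov A B C D T - M) i)
    · simpa using hpd.dotProduct_mulVec_pos hi
  · have h1 := HasCesaroMean.sum Finset.univ fun i _ =>
      hu.excess (he i) ((truncatedMarkov A B C D T - M) i)
    refine (congrArg (HasCesaroMean · _) (funext fun t => ?_)).mp h1
    rw [norm_sq_residual hT, norm_sq_residual hT, ← Finset.sum_sub_distrib]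
    simp

/-- If also the noise has limiting second moments, then the cost of the truncated Markov parameters
has a limit. -/
theorem exists_tendsto_regressionCost_truncatedMarkov
    {q : Fin p → ℝ} (hζ : ∀ i, HasCesaroMean (fun t => ζ t i ^ 2) (q i)) :
    ∃ c, Tendsto (regressionCost (systemOutput A B C D h₀ u ζ) (regressor T u)
      (truncatedMarkov A B C D T)) atTop (𝓝 c) := by
  have h1 : ∀ i, ∃ l, HasCesaroMean (fun t =>
      (unmodelledFunctional A C T i (hiddenState A B h₀ u (t + 1)) + ζ (t + T) i) ^ 2) l := by
    intro i
    obtain ⟨l, hl⟩ := hu.exists_state_sq (B := B) (h₀ := h₀) hA (unmodelledFunctional A C T i)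
    have h2 := (hu.noise_mul_state (B := B) (h₀ := h₀) hA (ζ := fun t => ζ t i)
      (fun s l => hζu s i l) (hζ i) T (unmodelledFunctional A C T i)).const_mul 2
    refine ⟨_, (congrArg (HasCesaroMean · _) (funext fun t => ?_)).mp
      ((hl.add h2).add ((shift_iff _ _ T).2 (hζ i)))⟩
    ring
  choose l hl using h1
  refine ⟨(∑ i, l i) / 2, (tendsto_regressionCost_iff _ _ _ T _).2 ?_⟩
  rw [mul_div_cancel₀ _ two_ne_zero]
  refine (congrArg (HasCesaroMean · _) (funext fun t => ?_)).mp
    (HasCesaroMean.sum Finset.univ fun i _ => hl i)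
  rw [norm_sq_residual hT]
  simp

end Regression

/-! ### Almost sure conclusion -/

theorem proposition2p2 {Ω : Type*} [MeasurableSpace Ω] (P : Measure Ω) [IsProbabilityMeasure P]
    {n m p : ℕ} (T : ℕ) (hT : 1 ≤ T)
    (A : Matrix (Fin n) (Fin n) ℝ) (B : Matrix (Fin n) (Fin m) ℝ)
    (C : Matrix (Fin p) (Fin n) ℝ) (D : Matrix (Fin p) (Fin m) ℝ)
    (hA : spectralRadius ℂ (A.map (algebraMap ℝ ℂ)) < 1)
    (h₀ : Ω → EuclideanSpace ℝ (Fin n))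
    (u : ℕ → Ω → EuclideanSpace ℝ (Fin m)) (ζ : ℕ → Ω → EuclideanSpace ℝ (Fin p))
    (S : Matrix (Fin m) (Fin m) ℝ) (hS : S.PosDef)
    (R : Matrix (Fin p) (Fin p) ℝ) (hR : R.PosSemidef)
    (hu : ∀ t, HasLaw (u t) (multivariateGaussian 0 S) P) (hu_indep : iIndepFun u P)
    (hζ : ∀ t, HasLaw (ζ t) (multivariateGaussian 0 R) P)
    (huζ : IndepFun (fun ω t => u t ω) (fun ω t => ζ t ω) P) :
    (∀ᵐ ω ∂P,
      (∃ J, IsLimitCost (systemOutput A B C D (h₀ ω) (fun t => u t ω) (fun t => ζ t ω))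
        (regressor T (fun t => u t ω)) J) →
      ∀ M, IsRegressionSolution
          (systemOutput A B C D (h₀ ω) (fun t => u t ω) (fun t => ζ t ω))
          (regressor T (fun t => u t ω)) M ↔
        M = truncatedMarkov A B C D T) ∧
    (iIndepFun ζ P → ∀ᵐ ω ∂P,
      ∀ M, IsRegressionSolution
          (systemOutput A B C D (h₀ ω) (fun t => u t ω) (fun t => ζ t ω))
          (regressor T (fun t => u t ω)) M ↔
        M = truncatedMarkov A B C D T) := by
  -- Lags and coordinates are countable, so a single null set serves all of them, and hence all `M`
  -- at once.
  have hwhite : ∀ᵐ ω ∂P, IsEmpiricallyWhite (fun t => u t ω) S := by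
    have h1 : ∀ᵐ ω ∂P, ∀ k l, HasCesaroMean (fun t => u t ω k * u t ω l) (S k l) :=
      ae_all_iff.2 fun k => ae_all_iff.2 fun l =>
        ae_hasCesaroMean_mul_apply hS.posSemidef hu hu_indep k l
    have h2 : ∀ᵐ ω ∂P, ∀ s, s ≠ 0 → ∀ k l, HasCesaroMean (fun t => u (t + s) ω k * u t ω l) 0 := by
      refine ae_all_iff.2 fun s => ?_
      by_cases hs : s = 0
      · exact ae_of_all _ fun ω h => absurd hs h
      · have := ae_all_iff.2 fun k => ae_all_iff.2 fun l =>
          ae_hasCesaroMean_lag_mul_apply hS.posSemidef hu hu_indep hs k l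
        filter_upwards [this] with ω hω _ using hω
    filter_upwards [h1, h2] with ω h1 h2 using ⟨h1, h2⟩
  have hcross : ∀ᵐ ω ∂P, ∀ s k l, HasCesaroMean (fun t => ζ (t + s) ω k * u t ω l) 0 :=
    ae_all_iff.2 fun s => ae_all_iff.2 fun k => ae_all_iff.2 fun l =>
      ae_hasCesaroMean_mul_apply_of_indepFun hS.posSemidef hR hu hu_indep hζ huζ s k l
  refine ⟨?_, fun hζ_indep => ?_⟩
  · filter_upwards [hwhite, hcross] with ω h1 h2
    rintro ⟨J, hJ⟩
    exact isRegressionSolution_iff_eq_truncatedMarkov hT hA h1 h2 hS (hJ _)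
  · have hnoise : ∀ᵐ ω ∂P, ∀ k, HasCesaroMean (fun t => ζ t ω k * ζ t ω k) (R k k) :=
      ae_all_iff.2 fun k => ae_hasCesaroMean_mul_apply hR hζ hζ_indep k k
    filter_upwards [hwhite, hcross, hnoise] with ω h1 h2 h3
    obtain ⟨c, hc⟩ := exists_tendsto_regressionCost_truncatedMarkov (h₀ := h₀ ω) (B := B) (C := C)
      (D := D) (ζ := fun t => ζ t ω) (q := fun k => R k k) hT hA h1 h2
      (fun k => by simpa only [sq] using h3 k)
    exact isRegressionSolution_iff_eq_truncatedMarkov hT hA h1 h2 hS hc
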